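/- Let $n\ge 1$ and let $f=(f_1,\dots,f_n)$ with $f_i\in\mathbb R[x]=\mathbb R[x_1,\dots,x_n]$. Let $$\mathrm{Sol}(f)=\{\alpha\in\mathbb R^n:\ \alpha\ge 0,\ f(\alpha)\ge 0,\ \langle\alpha\mid f(\alpha)\rangle=0\}$$ be the solution set of the polynomial complementarity problem given by $f$. For an ideal $I$ of a real polynomial ring, $V_{\mathbb C}(I)$ denotes its set of complex zeros and $\mathrm{rad}(I)$ its radical. Assume that $f$ is $\mathcal D_0$, i.e. that $V_{\mathbb C}(\langle x_1f_1,\dots,x_nf_n\rangle)$ is finite. With slack variables $z=(z_1,\dots,z_{2n})$ put $$I[f,z]=\langle x_if_i,\ z_i^2-x_i,\ z_{n+i}^2-f_i:\ i=1,\dots,n\rangle\subset\mathbb R[x,z],\qquad \delta=\#V_{\mathbb C}(I[f,z]).$$ A list $[w,v_1,\dots,v_n]$ of polynomials in $\mathbb R[t]$ is called a univariate representation of $\mathrm{Sol}(f)$ if $\deg w=\delta$, $\deg v_i<\deg w$ for all $i$, and $$\mathrm{Sol}(f)=\{(v_1(t),\dots,v_n(t)):\ w(t)=0,\ t\in\mathbb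 R\}.\qquad(*)$$ For $s\in\mathbb N$ let $H(s)\in\mathbb R^{3n\times 3n}$ be the inverse of the matrix whose first row is $(1,s,s^2,\dots,s^{3n-1})$ (with $0^0=1$) and whose other rows are those of the identity matrix. Consider the following algorithm with input $f$. Start with $s=0$ and repeat: substitute $(x,z)=H(s)y$ in the $3n$ listed generators of $I[f,z]$; let $I_h\subset\mathbb R[y_1,\dots,y_{3n}]$ be the ideal generated by the resulting polynomials; compute the reduced Gröbner basis $G$ of $\mathrm{rad}(I_h)$ for the pure lexicographic order with $y_1<y_2<\dots<y_{3n}$; if $G=[w,y_2-u_2,\dots,y_{3n}-u_{3n}]$ with $w,u_2,\dots,u_{3n}\in\mathbb R[y_1]$, leave the loop, otherwise replace $s$ by $s+1$. After the loop, let $(v_1,\dots,v_n)$ be the first $n$ coordinates of $H(s)\,(t,u_2(t),\dots,u_{3n}(t))^T$ and return $[w,v_1,\dots,v_n]$. **Theorem.** On the input $f$ the algorithm terminates after at most $(3n-1)\delta(\delta-1)/2+1$ iterations of its loop. Its output $[w,v_1,\dots,v_n]$ satisfies $(*)$ and $\deg w=\delta$. If $\delta\ge 2$, the output is a univariate representation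 of $\mathrm{Sol}(f)$. In all cases (including $\delta=1$) the list $[w,\,v_1\bmod w,\dots,v_n\bmod w]$, in which each $v_i$ is replaced by its remainder on division by $w$, is a univariate representation of $\mathrm{Sol}(f)$. -/

import Mathlib

/-! ## Polynomial complementarity problems -/

namespace PCP

/-- The solution set `Sol(f)` of the problem `x ≥ 0`, `f(x) ≥ 0`, `⟨x | f(x)⟩ = 0`. -/
def Sol {n : ℕ} (f : Fin n → MvPolynomial (Fin n) ℝ) : Set (Fin n → ℝ) :=
  {α | (∀ i, 0 ≤ α i) ∧ (∀ i, 0 ≤ MvPolynomial.eval α (f i)) ∧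
    ∑ i, α i * MvPolynomial.eval α (f i) = 0}

/-- The complex algebraic variety of an ideal of a real polynomial ring. -/
def complexVariety {σ : Type*} (I : Ideal (MvPolynomial σ ℝ)) : Set (σ → ℂ) :=
  {a | ∀ g ∈ I, MvPolynomial.aeval a g = 0}

/-- The ideal `⟨x₁ f₁, …, xₙ fₙ⟩`. -/
noncomputable def compIdeal {n : ℕ} (f : Fin n → MvPolynomial (Fin n) ℝ) :
    Ideal (MvPolynomial (Fin n) ℝ) :=
  Ideal.span (Set.range fun i => MvPolynomial.X i * f i)

/-- `f` is `D₀`: the complex variety of `⟨x₁ f₁, …, xₙ fₙ⟩` is finite. -/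
def IsD0 {n : ℕ} (f : Fin n → MvPolynomial (Fin n) ℝ) : Prop :=
  (complexVariety (compIdeal f)).Finite

/-! ## Slack variables

The `3 n` variables `(x, z) = (x₁, …, xₙ, z₁, …, z₂ₙ)` are indexed, in this order, by
`Fin (3 * n)`. -/

/-- Position of `xᵢ` in `(x, z)`. -/
def xIdx {n : ℕ} (i : Fin n) : Fin (3 * n) := ⟨i, by omega⟩

/-- Position of `zᵢ`, `i ≤ n`, in `(x, z)`. -/
def zIdx {n : ℕ} (i : Fin n) : Fin (3 * n) := ⟨n + i, by omega⟩

/-- Position of `zₙ₊ᵢ`, `i ≤ n`, in `(x, z)`. -/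
def zIdx' {n : ℕ} (i : Fin n) : Fin (3 * n) := ⟨2 * n + i, by omega⟩

/-- The `3 n` polynomials `xᵢ fᵢ`, `zᵢ² - xᵢ`, `zₙ₊ᵢ² - fᵢ`, for `i = 1, …, n`, of `ℝ[x, z]`. -/
noncomputable def slackPolys {n : ℕ} (f : Fin n → MvPolynomial (Fin n) ℝ) :
    Fin n ⊕ Fin n ⊕ Fin n → MvPolynomial (Fin (3 * n)) ℝ
  | .inl i => MvPolynomial.X (xIdx i) * MvPolynomial.rename xIdx (f i)
  | .inr (.inl i) => MvPolynomial.X (zIdx i) ^ 2 - MvPolynomial.X (xIdx i)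
  | .inr (.inr i) => MvPolynomial.X (zIdx' i) ^ 2 - MvPolynomial.rename xIdx (f i)

/-- The ideal `I[f, z]` of `ℝ[x, z]`. -/
noncomputable def slackIdeal {n : ℕ} (f : Fin n → MvPolynomial (Fin n) ℝ) :
    Ideal (MvPolynomial (Fin (3 * n)) ℝ) :=
  Ideal.span (Set.range (slackPolys f))

/-! ## Univariate representations -/

/-- `Sol(f) = {(v₁(t), …, vₙ(t)) : w(t) = 0, t ∈ ℝ}`. -/
def Parametrizes {n : ℕ} (f : Fin n → MvPolynomial (Fin n) ℝ)
    (w : Polynomial ℝ) (v : Fin n → Polynomial ℝ) : Prop :=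
  Sol f = {α | ∃ t : ℝ, w.eval t = 0 ∧ α = fun i => (v i).eval t}

/-- `[w, v₁, …, vₙ]` is a univariate representation of `Sol(f)`. -/
structure IsUnivariateRepresentation {n : ℕ} (f : Fin n → MvPolynomial (Fin n) ℝ)
    (w : Polynomial ℝ) (v : Fin n → Polynomial ℝ) : Prop where
  parametrizes : Parametrizes f w v
  degree_w : (complexVariety (slackIdeal f)).encard = w.natDegree
  degree_v : ∀ i, (v i).degree < w.degree

/-! ## Gröbner bases -/

/-- The pure lexicographic monomial order with `y₁ < y₂ < ⋯ < yₘ`. (In `MonomialOrder.lex` the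
first variable is the largest one, so the variables are reversed.) -/
noncomputable def lexAsc (m : ℕ) : MonomialOrder (Fin m) where
  syn := Lex (Fin m →₀ ℕ)
  toSyn :=
  { toEquiv := (Finsupp.equivCongrLeft Fin.revPerm).trans toLex
    map_add' := by
      intro a b
      apply ofLex.injective
      ext i
      simp }
  toSyn_monotone := by
    intro a b h
    have hab : Finsupp.equivMapDomain Fin.revPerm a ≤ Finsupp.equivMapDomain Fin.revPerm b :=
      fun i => by simpa using h _
    exact Finsupp.toLex_monotone hab

theorem lexAsc_lt_iff (m : ℕ) (a b : Fin m →₀ ℕ) :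
    (lexAsc m).toSyn a < (lexAsc m).toSyn b ↔ ∃ i, (∀ j, i < j → a j = b j) ∧ a i < b i := by
  have key : (lexAsc m).toSyn a < (lexAsc m).toSyn b ↔
      ∃ i, (∀ j, j < i → Finsupp.equivMapDomain Fin.revPerm a j =
        Finsupp.equivMapDomain Fin.revPerm b j) ∧
        Finsupp.equivMapDomain Fin.revPerm a i < Finsupp.equivMapDomain Fin.revPerm b i :=
    Finsupp.Lex.lt_iff
  rw [key]
  constructor
  · rintro ⟨j, h1, h2⟩
    refine ⟨j.rev, fun i hi => ?_, by simpa using h2⟩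
    simpa using h1 i.rev (Fin.rev_lt_iff.mp hi)
  · rintro ⟨j, h1, h2⟩
    refine ⟨j.rev, fun i hi => ?_, by simpa using h2⟩
    simpa using h1 i.rev (Fin.lt_rev_iff.mp hi)

/-- `G` is a Gröbner basis of `I`. -/
structure IsGroebnerBasis {σ : Type*} (ord : MonomialOrder σ)
    (I : Ideal (MvPolynomial σ ℝ)) (G : Set (MvPolynomial σ ℝ)) : Prop where
  finite : G.Finite
  subset : ∀ p ∈ G, p ∈ I
  span_leadingTerm : Ideal.span (ord.leadingTerm '' G) =
    Ideal.span (ord.leadingTerm '' (I : Set (MvPolynomial σ ℝ)))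

/-- `G` is a reduced Gröbner basis of `I`. -/
structure IsReducedGroebnerBasis {σ : Type*} (ord : MonomialOrder σ)
    (I : Ideal (MvPolynomial σ ℝ)) (G : Set (MvPolynomial σ ℝ)) : Prop
    extends IsGroebnerBasis ord I G where
  leadingCoeff_eq_one : ∀ p ∈ G, ord.leadingCoeff p = 1
  reduced : ∀ p ∈ G, ∀ d ∈ p.support,
    MvPolynomial.monomial d (1 : ℝ) ∉ Ideal.span (ord.leadingTerm '' (G \ {p}))

/-! ## The algorithm -/

/-- The index of the first of the `3 n` variables. -/
def first (n : ℕ) [NeZero n] : Fin (3 * n) :=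
  ⟨0, by have := NeZero.pos n; omega⟩

/-- The matrix with first row `(1, s, s², …, s^(3n-1))` and the other rows those of the identity
matrix. -/
def rowMatrix (n : ℕ) [NeZero n] (s : ℕ) : Matrix (Fin (3 * n)) (Fin (3 * n)) ℝ :=
  Matrix.of fun i j => if i = first n then (s : ℝ) ^ (j : ℕ) else if i = j then 1 else 0

/-- The matrix `H = H(s)`. -/
noncomputable def H (n : ℕ) [NeZero n] (s : ℕ) : Matrix (Fin (3 * n)) (Fin (3 * n)) ℝ :=
  (rowMatrix n s)⁻¹

/-- The ideal `I_h = ⟨h₁, …, h₃ₙ⟩` of `ℝ[y₁, …, y₃ₙ]`, where the `hᵢ` are obtained from the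
generators of `I[f, z]` by the change of variables `(x, z) = H(s) y`. -/
noncomputable def transformedIdeal {n : ℕ} [NeZero n] (f : Fin n → MvPolynomial (Fin n) ℝ)
    (s : ℕ) : Ideal (MvPolynomial (Fin (3 * n)) ℝ) :=
  Ideal.span (Set.range fun k =>
    MvPolynomial.aeval
      (fun i => ∑ j, MvPolynomial.C (H n s i j) * MvPolynomial.X j :
        Fin (3 * n) → MvPolynomial (Fin (3 * n)) ℝ)
      (slackPolys f k))

/-- A univariate polynomial, written in the variable `y₁`. -/
noncomputable def inFirst {n : ℕ} [NeZero n] (p : Polynomial ℝ) : MvPolynomial (Fin (3 * n)) ℝ :=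
  Polynomial.aeval (MvPolynomial.X (first n)) p

/-- `G = [w, y₂ - u₂, …, y₃ₙ - u₃ₙ]` with `w, u₂, …, u₃ₙ` in `ℝ[y₁]`. The family `u` is completed
by `u₁ = t`, so that `u(t) = (t, u₂(t), …, u₃ₙ(t))`. -/
def HasShape {n : ℕ} [NeZero n] (G : Set (MvPolynomial (Fin (3 * n)) ℝ))
    (w : Polynomial ℝ) (u : Fin (3 * n) → Polynomial ℝ) : Prop :=
  u (first n) = Polynomial.X ∧
    G = {inFirst w} ∪ {p | ∃ i, i ≠ first n ∧ p = MvPolynomial.X i - inFirst (u i)}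

/-- The first `n` coordinates of `H(s) (t, u₂(t), …, u₃ₙ(t))ᵀ`. -/
noncomputable def outputV {n : ℕ} [NeZero n] (s : ℕ) (u : Fin (3 * n) → Polynomial ℝ) :
    Fin n → Polynomial ℝ :=
  fun i => ∑ j, Polynomial.C (H n s (xIdx i) j) * u j

/-- Configurations of the algorithm. -/
inductive Config (n : ℕ) : Type
  /-- At the test of the while loop, with `shape = false` and the given value of `s`. -/
  | loop (s : ℕ) : Config n
  /-- At the test of the while loop, with `shape = true`, the basis being given by `w` and `u`. -/
  | shaped (s : ℕ) (w : Polynomial ℝ) (u : Fin (3 * n) → Polynomial ℝ) : Config n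
  /-- Halted, having returned `[w, v₁, …, vₙ]`. -/
  | returned (w : Polynomial ℝ) (v : Fin n → Polynomial ℝ) : Config n

/-- `Step f c k c'`: on input `f` the algorithm passes from `c` to `c'`, executing the body of the
while loop `k` times (`k = 1` or `k = 0`). The body computes the reduced Gröbner basis `G` of the
radical of the transformed ideal and tests its form. -/
inductive Step {n : ℕ} [NeZero n] (f : Fin n → MvPolynomial (Fin n) ℝ) :
    Config n → ℕ → Config n → Prop
  | again (s : ℕ) (G : Set (MvPolynomial (Fin (3 * n)) ℝ))
      (hG : IsReducedGroebnerBasis (lexAsc (3 * n)) (transformedIdeal f s).radical G)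
      (hshape : ¬ ∃ w u, HasShape G w u) :
      Step f (.loop s) 1 (.loop (s + 1))
  | stop_loop (s : ℕ) (G : Set (MvPolynomial (Fin (3 * n)) ℝ))
      (w : Polynomial ℝ) (u : Fin (3 * n) → Polynomial ℝ)
      (hG : IsReducedGroebnerBasis (lexAsc (3 * n)) (transformedIdeal f s).radical G)
      (hshape : HasShape G w u) :
      Step f (.loop s) 1 (.shaped s w u)
  | output (s : ℕ) (w : Polynomial ℝ) (u : Fin (3 * n) → Polynomial ℝ) :
      Step f (.shaped s w u) 0 (.returned w (outputV s u))

/-- `Exec f c k c'`: some sequence of steps leads from `c` to `c'`, with `k` executions of the body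
of the while loop in total. -/
inductive Exec {n : ℕ} [NeZero n] (f : Fin n → MvPolynomial (Fin n) ℝ) :
    Config n → ℕ → Config n → Prop
  | refl (c : Config n) : Exec f c 0 c
  | tail {c c' c'' : Config n} {k l : ℕ} (h : Exec f c k c') (h' : Step f c' l c'') :
      Exec f c (k + l) c''

/-- On input `f`, the algorithm terminates after exactly `k` iterations of its while loop and
returns `[w, v₁, …, vₙ]`: every partial execution from the initial configuration `s = 0`,
`shape = false` extends to an execution that does so (in particular none is stuck or infinite). -/
def Returns {n : ℕ} [NeZero n] (f : Fin n → MvPolynomial (Fin n) ℝ)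
    (k : ℕ) (w : Polynomial ℝ) (v : Fin n → Polynomial ℝ) : Prop :=
  ∀ (j : ℕ) (c : Config n), Exec f (.loop 0) j c →
    ∃ l, j + l = k ∧ Exec f c l (.returned w v)

end PCP

/-! Let V be the complex variety of `slackIdeal f`. It is finite because f is D₀ and each slack
variable is a square root of a value determined by the x-part, and it is never empty, so δ ≥ 1. The
change of variables carries V bijectively onto the variety of `transformedIdeal f s`, and the new
coordinate y₁ is the linear form ∑ sʲ aⱼ on V. By the Nullstellensatz the radical consists of the
real polynomials vanishing on that variety.

The loop stops exactly when y₁ separates these δ points. If the reduced basis has the required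
shape, every coordinate is a function of y₁ (`HasShape.separates`). Conversely, if y₁ separates,
Lagrange interpolation expresses the coordinates through y₁; the variety is stable under
conjugation, so the interpolants are real, and they form a reduced Gröbner basis
(`IsShapeOf.isReducedGroebnerBasis`). Uniqueness of reduced bases makes this the one computed.

Two distinct points of V share their y₁ only when s is a root of a nonzero polynomial of degree at
most 3n - 1. With δ(δ-1)/2 pairs, this bounds the number of failures (`exists_separates`).

Finally, w and u are real, so real roots of w correspond to real points of V, and these project onto
Sol(f), since being a real square encodes nonnegativity (`mem_Sol_iff`). Reduction modulo w matters
only for δ = 1, where the coordinate t has the same degree as w. -/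

namespace PCP

open MvPolynomial ComplexConjugate

/-! ### Existence and uniqueness of reduced Gröbner bases -/

section Groebner

variable {σ : Type*} {ord : MonomialOrder σ} {I : Ideal (MvPolynomial σ ℝ)}
  {G G' : Set (MvPolynomial σ ℝ)}

theorem leadingTerm_image_of_monic (hG : ∀ p ∈ G, ord.leadingCoeff p = 1) :
    ord.leadingTerm '' G = (fun d => monomial d (1 : ℝ)) '' (ord.degree '' G) := by
  rw [Set.image_image]
  exact Set.image_congr fun p hp => by rw [MonomialOrder.leadingTerm, hG p hp]

theorem monomial_mem_span_leadingTerm_iff (hG : ∀ p ∈ G, ord.leadingCoeff p = 1) (d : σ →₀ ℕ) :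
    monomial d (1 : ℝ) ∈ Ideal.span (ord.leadingTerm '' G) ↔ ∃ g ∈ G, ord.degree g ≤ d := by
  classical
  rw [leadingTerm_image_of_monic hG, mem_ideal_span_monomial_image]
  simp [support_monomial]

/-- Membership of a monomial in a monomial ideal is divisibility by a generator, and over a field
leading terms may be normalized to be monic. -/
theorem span_leadingTerm_eq_iff (hG : ∀ p ∈ G, ord.leadingCoeff p = 1) (hGI : ∀ p ∈ G, p ∈ I) :
    Ideal.span (ord.leadingTerm '' G) =
      Ideal.span (ord.leadingTerm '' (I : Set (MvPolynomial σ ℝ))) ↔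
    ∀ p ∈ I, p ≠ 0 → ∃ g ∈ G, ord.degree g ≤ ord.degree p := by
  constructor
  · intro h p hp hp0
    rw [← monomial_mem_span_leadingTerm_iff hG, h]
    have h1 : ord.leadingTerm p ∈ Ideal.span (ord.leadingTerm '' (I : Set (MvPolynomial σ ℝ))) :=
      Ideal.subset_span ⟨p, hp, rfl⟩
    have h2 := Ideal.mul_mem_left _ (C (ord.leadingCoeff p)⁻¹) h1
    rwa [MonomialOrder.leadingTerm, C_mul_monomial,
      inv_mul_cancel₀ (MonomialOrder.leadingCoeff_ne_zero_iff.2 hp0)] at h2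
  · intro h
    refine le_antisymm (Ideal.span_mono (Set.image_mono hGI)) (Ideal.span_le.2 ?_)
    rintro _ ⟨p, hp, rfl⟩
    by_cases hp0 : p = 0
    · simp [hp0]
    · rw [SetLike.mem_coe, ← MonomialOrder.C_mul_leadingCoeff_monomial_degree]
      exact Ideal.mul_mem_left _ _ ((monomial_mem_span_leadingTerm_iff hG _).2 (h p hp hp0))

/-- Reduced Gröbner bases, described by the divisibility of leading exponents. -/
theorem isReducedGroebnerBasis_iff : IsReducedGroebnerBasis ord I G ↔
    G.Finite ∧ (∀ p ∈ G, p ∈ I) ∧ (∀ p ∈ G, ord.leadingCoeff p = 1) ∧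
    (∀ p ∈ I, p ≠ 0 → ∃ g ∈ G, ord.degree g ≤ ord.degree p) ∧
    ∀ p ∈ G, ∀ d ∈ p.support, ∀ g ∈ G, g ≠ p → ¬ ord.degree g ≤ d := by
  have key (hG : ∀ p ∈ G, ord.leadingCoeff p = 1) (p : MvPolynomial σ ℝ) (d : σ →₀ ℕ) :
      monomial d (1 : ℝ) ∉ Ideal.span (ord.leadingTerm '' (G \ {p})) ↔
        ∀ g ∈ G, g ≠ p → ¬ ord.degree g ≤ d := by
    rw [monomial_mem_span_leadingTerm_iff fun q hq => hG q hq.1]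
    simp only [Set.mem_sdiff, Set.mem_singleton_iff, not_exists, not_and, and_imp]
  constructor
  · rintro ⟨⟨h1, h2, h3⟩, h4, h5⟩
    exact ⟨h1, h2, h4, (span_leadingTerm_eq_iff h4 h2).1 h3,
      fun p hp d hd => (key h4 p d).1 (h5 p hp d hd)⟩
  · rintro ⟨h1, h2, h3, h4, h5⟩
    exact ⟨⟨h1, h2, (span_leadingTerm_eq_iff h3 h2).2 h4⟩, h3,
      fun p hp d hd => (key h3 p d).2 (h5 p hp d hd)⟩

theorem ne_zero_of_leadingCoeff_eq_one {p : MvPolynomial σ ℝ} (hp : ord.leadingCoeff p = 1) :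
    p ≠ 0 :=
  MonomialOrder.leadingCoeff_ne_zero_iff.1 (hp ▸ one_ne_zero)

theorem degree_sub_lt_of_monic {p q : MvPolynomial σ ℝ} (hp : ord.leadingCoeff p = 1)
    (hq : ord.leadingCoeff q = 1) (hpq : ord.degree p = ord.degree q) (hne : p - q ≠ 0) :
    ord.toSyn (ord.degree (p - q)) < ord.toSyn (ord.degree p) := by
  refine lt_of_le_of_ne ?_ fun h => ?_
  · simpa [hpq] using ord.degree_sub_le (f := p) (g := q)
  · have h' := ord.toSyn.injective h
    have := ord.coeff_degree_ne_zero_iff.2 hne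
    rw [h', coeff_sub] at this
    nth_rewrite 2 [hpq] at this
    exact this (by rw [← MonomialOrder.leadingCoeff, ← MonomialOrder.leadingCoeff, hp, hq, sub_self])

/-- Reducedness forces g and some g' in G' to share their leading exponent. If g - g' ≠ 0, its
leading exponent is smaller, occurs in g or g', and is divisible by leading exponents of other
elements of both bases; this contradicts reducedness of one of them. -/
theorem IsReducedGroebnerBasis.subset_of_isReducedGroebnerBasis
    (h : IsReducedGroebnerBasis ord I G) (h' : IsReducedGroebnerBasis ord I G') : G ⊆ G' := by
  obtain ⟨-, hI, hm, hd, hr⟩ := isReducedGroebnerBasis_iff.1 h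
  obtain ⟨-, hI', hm', hd', hr'⟩ := isReducedGroebnerBasis_iff.1 h'
  intro g hg
  have hg0 := ne_zero_of_leadingCoeff_eq_one (hm g hg)
  obtain ⟨g', hg', hle⟩ := hd' g (hI g hg) hg0
  obtain ⟨g'', hg'', hle'⟩ := hd g' (hI' g' hg') (ne_zero_of_leadingCoeff_eq_one (hm' g' hg'))
  have hgg : g'' = g := by
    by_contra hne
    exact hr g hg _ (ord.degree_mem_support hg0) g'' hg'' hne (hle'.trans hle)
  subst hgg
  have hdeg : ord.degree g'' = ord.degree g' := le_antisymm hle' hle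
  suffices g'' - g' = 0 by rwa [sub_eq_zero.1 this]
  by_contra hne
  have hlt := degree_sub_lt_of_monic (hm _ hg) (hm' _ hg') hdeg hne
  obtain ⟨g₁, hg₁, hle₁⟩ := hd _ (I.sub_mem (hI _ hg) (hI' _ hg')) hne
  obtain ⟨g₂, hg₂, hle₂⟩ := hd' _ (hI _ hg₁) (ne_zero_of_leadingCoeff_eq_one (hm _ hg₁))
  have hne₁ : g₁ ≠ g'' := by
    rintro rfl
    exact absurd (ord.toSyn_monotone hle₁) hlt.not_ge
  have hne₂ : g₂ ≠ g' := by
    rintro rfl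
    exact absurd (ord.toSyn_monotone (hle₂.trans hle₁)) (hdeg ▸ hlt.not_ge)
  classical
  rcases Finset.mem_union.1 (support_sub _ _ _ (ord.degree_mem_support hne)) with hs | hs
  · exact hr _ hg _ hs _ hg₁ hne₁ hle₁
  · exact hr' _ hg' _ hs _ hg₂ hne₂ (hle₂.trans hle₁)

theorem IsReducedGroebnerBasis.unique (h : IsReducedGroebnerBasis ord I G)
    (h' : IsReducedGroebnerBasis ord I G') : G = G' :=
  (h.subset_of_isReducedGroebnerBasis h').antisymm (h'.subset_of_isReducedGroebnerBasis h)

/-- For a minimal leading exponent `d` of `I`, there is a monic element of `I` with this leading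
exponent, all of whose other exponents are standard. -/
theorem exists_monic_standard_tail {d : σ →₀ ℕ}
    (hdom : ∀ p ∈ I, p ≠ 0 →
      ∃ e, Minimal (fun e => ∃ p ∈ I, p ≠ 0 ∧ ord.degree p = e) e ∧ e ≤ ord.degree p)
    (hd : Minimal (fun e => ∃ p ∈ I, p ≠ 0 ∧ ord.degree p = e) d) :
    ∃ b ∈ I, ord.leadingCoeff b = 1 ∧ ord.degree b = d ∧
      ∀ c ∈ b.support, c = d ∨
        ∀ e, Minimal (fun e => ∃ p ∈ I, p ≠ 0 ∧ ord.degree p = e) e → ¬ e ≤ c := by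
  classical
  let B : Set (MvPolynomial σ ℝ) := {p | p ∈ I ∧ p ≠ 0}
  have hB : ∀ b ∈ B, IsUnit (ord.leadingCoeff b) := fun b hb =>
    (MonomialOrder.leadingCoeff_ne_zero_iff.2 hb.2).isUnit
  -- Division by all nonzero elements of I gives the normal form r of the monomial, with only
  -- standard exponents; the required element is the monomial minus r.
  obtain ⟨g, r, hgr, -, hr⟩ := ord.div_set hB (monomial d (1 : ℝ))
  have hrM : ∀ c ∈ r.support, ∀ e,
      Minimal (fun e => ∃ p ∈ I, p ≠ 0 ∧ ord.degree p = e) e → ¬ e ≤ c := by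
    intro c hc e he hec
    obtain ⟨p, hp, hp0, rfl⟩ := he.prop
    exact hr c hc p ⟨hp, hp0⟩ hec
  have hmem : monomial d (1 : ℝ) - r ∈ I := by
    rw [hgr, add_sub_cancel_right, Finsupp.linearCombination_apply]
    exact Ideal.sum_mem _ fun b _ => I.mul_mem_left _ b.2.1
  have hdr : coeff d r = 0 := by
    by_contra h
    exact hrM d (mem_support_iff.2 h) d hd le_rfl
  have hcoeff : coeff d (monomial d (1 : ℝ) - r) = 1 := by simp [hdr]
  have h0 : monomial d (1 : ℝ) - r ≠ 0 := by
    intro h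
    simp [h] at hcoeff
  have hsupp : ∀ c ∈ (monomial d (1 : ℝ) - r).support, c = d ∨ c ∈ r.support := by
    intro c hc
    by_contra! hcd
    have : coeff c r = 0 := by simpa using hcd.2
    exact mem_support_iff.1 hc (by simp [coeff_monomial, hcd.1.symm, this])
  have hdeg : ord.degree (monomial d (1 : ℝ) - r) = d := by
    obtain ⟨e, he, hle⟩ := hdom _ hmem h0
    exact (hsupp _ (ord.degree_mem_support h0)).resolve_right fun h => hrM _ h e he hle
  exact ⟨_, hmem, by rw [MonomialOrder.leadingCoeff, hdeg, hcoeff], hdeg,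
    fun c hc => (hsupp c hc).imp_right fun h => hrM c h⟩

theorem exists_isReducedGroebnerBasis [Finite σ] (ord : MonomialOrder σ)
    (I : Ideal (MvPolynomial σ ℝ)) : ∃ G, IsReducedGroebnerBasis ord I G := by
  let D : (σ →₀ ℕ) → Prop := fun e => ∃ p ∈ I, p ≠ 0 ∧ ord.degree p = e
  have hdom : ∀ p ∈ I, p ≠ 0 → ∃ e, Minimal D e ∧ e ≤ ord.degree p := by
    intro p hp hp0
    obtain ⟨e, hle, he⟩ := exists_minimal_le_of_wellFoundedLT D (ord.degree p) ⟨p, hp, hp0, rfl⟩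
    exact ⟨e, he, hle⟩
  -- Dickson's lemma: minimal exponents form an antichain in a well-quasi-order.
  have hfin : {d | Minimal D d}.Finite :=
    WellQuasiOrderedLE.finite_of_isAntichain (setOfPred_minimal_antichain D)
  choose! b hbI hbm hbd hbt using fun d (hd : Minimal D d) => exists_monic_standard_tail hdom hd
  refine ⟨b '' {d | Minimal D d}, isReducedGroebnerBasis_iff.2 ⟨hfin.image b, ?_, ?_, ?_, ?_⟩⟩
  · rintro _ ⟨d, hd, rfl⟩
    exact hbI d hd
  · rintro _ ⟨d, hd, rfl⟩
    exact hbm d hd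
  · intro p hp hp0
    obtain ⟨e, he, hle⟩ := hdom p hp hp0
    exact ⟨b e, ⟨e, he, rfl⟩, (hbd e he).trans_le hle⟩
  · rintro _ ⟨d, hd, rfl⟩ c hc _ ⟨e, he, rfl⟩ hne hle
    rw [hbd e he] at hle
    rcases hbt d hd c hc with rfl | h
    · exact hne (congrArg b (hd.eq_of_le he.prop hle))
    · exact h e he hle

end Groebner

/-! ### Real interpolation at a set of complex nodes stable under conjugation -/

/-- Conjugating the coefficients of the Lagrange interpolant gives another interpolant of the same
data, so by uniqueness the coefficients are real. -/
theorem exists_real_interpolation (S : Finset ℂ) (hS : ∀ z ∈ S, conj z ∈ S) (g : ℂ → ℂ)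
    (hg : ∀ z ∈ S, g (conj z) = conj (g z)) :
    ∃ u : Polynomial ℝ, u.degree < S.card ∧ ∀ z ∈ S, Polynomial.aeval z u = g z := by
  classical
  have hinj : Set.InjOn (id : ℂ → ℂ) S := Function.injective_id.injOn
  set P := Lagrange.interpolate S id g with hP
  have hdeg : P.degree < S.card := Lagrange.degree_interpolate_lt g hinj
  have heval : ∀ z ∈ S, P.eval z = g z := fun z hz =>
    Lagrange.eval_interpolate_at_node g hinj hz
  have hconj : P.map (starRingEnd ℂ) = P := by
    refine Polynomial.eq_of_degrees_lt_of_eval_finset_eq S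
      (Polynomial.degree_map_le.trans_lt hdeg) hdeg fun z hz => ?_
    have h := Polynomial.eval_map_apply (p := P) (f := starRingEnd ℂ) (conj z)
    rw [Complex.conj_conj] at h
    rw [h, heval _ (hS z hz), heval z hz, hg z hz, Complex.conj_conj]
  have hlift : P ∈ Polynomial.lifts (algebraMap ℝ ℂ) := by
    rw [Polynomial.lifts_iff_coeff_lifts]
    intro k
    have h := congrArg (fun Q : Polynomial ℂ => Q.coeff k) hconj
    simp only [Polynomial.coeff_map] at h
    obtain ⟨r, hr⟩ := Complex.conj_eq_iff_real.1 h
    exact ⟨r, hr.symm⟩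
  obtain ⟨u, hu⟩ := (Polynomial.mem_lifts P).1 hlift
  refine ⟨u, ?_, fun z hz => ?_⟩
  · rwa [← hu, Polynomial.degree_map] at hdeg
  · rw [← heval z hz, ← hu, Polynomial.eval_map_algebraMap]

theorem exists_real_monic_rootSet (S : Finset ℂ) (hS : ∀ z ∈ S, conj z ∈ S) :
    ∃ w : Polynomial ℝ, w.Monic ∧ w.natDegree = S.card ∧
      ∀ z : ℂ, Polynomial.aeval z w = 0 ↔ z ∈ S := by
  classical
  -- With u interpolating z ^ S.card, X ^ S.card - u is monic, real and vanishes on S; its degree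
  -- leaves room for no further root.
  obtain ⟨u, hu, hval⟩ := exists_real_interpolation S hS (fun z => z ^ S.card)
    fun z _ => by simp
  have hm : (Polynomial.X ^ S.card - u).Monic := Polynomial.monic_X_pow_sub hu
  have hd : (Polynomial.X ^ S.card - u).natDegree = S.card :=
    Polynomial.natDegree_eq_of_degree_eq_some (by
      rw [Polynomial.degree_sub_eq_left_of_degree_lt] <;> simp [hu])
  refine ⟨_, hm, hd, fun z => ?_⟩
  have hsub : S ⊆ ((Polynomial.X ^ S.card - u).map (algebraMap ℝ ℂ)).roots.toFinset := by
    intro z hz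
    rw [Multiset.mem_toFinset, Polynomial.mem_roots (hm.map _).ne_zero, Polynomial.IsRoot,
      Polynomial.eval_map_algebraMap, map_sub, hval z hz]
    simp
  have heq := Finset.eq_of_subset_of_card_le hsub ((Multiset.toFinset_card_le _).trans
    ((Polynomial.card_roots' _).trans (by rw [Polynomial.natDegree_map, hd])))
  conv_rhs => rw [heq, Multiset.mem_toFinset, Polynomial.mem_roots (hm.map _).ne_zero,
    Polynomial.IsRoot, Polynomial.eval_map_algebraMap]

/-! ### Polynomials in the first variable -/

section inFirst

variable {n : ℕ} [NeZero n]

theorem inFirst_eq_sum (p : Polynomial ℝ) :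
    (inFirst p : MvPolynomial (Fin (3 * n)) ℝ) =
      ∑ k ∈ p.support, monomial (Finsupp.single (first n) k) (p.coeff k) := by
  rw [inFirst, Polynomial.aeval_eq_sum_range']
  rotate_left
  · exact Nat.lt_succ_self _
  rw [← Finset.sum_subset Polynomial.supp_subset_range_natDegree_succ]
  · refine Finset.sum_congr rfl fun k _ => ?_
    rw [X_pow_eq_monomial, smul_monomial, smul_eq_mul, mul_one]
  · intro k _ hk
    simp [Polynomial.notMem_support_iff.1 hk]

theorem coeff_single_inFirst (p : Polynomial ℝ) (k : ℕ) :
    coeff (Finsupp.single (first n) k) (inFirst p) = p.coeff k := by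
  classical
  simp +contextual [inFirst_eq_sum, coeff_sum, coeff_monomial,
    (Finsupp.single_injective (first n)).eq_iff, eq_comm]

theorem exists_of_mem_support_inFirst {p : Polynomial ℝ} {d : Fin (3 * n) →₀ ℕ}
    (hd : d ∈ (inFirst p).support) : ∃ k ∈ p.support, d = Finsupp.single (first n) k := by
  classical
  by_contra! h
  refine mem_support_iff.1 hd ?_
  rw [inFirst_eq_sum, coeff_sum]
  exact Finset.sum_eq_zero fun k hk => by rw [coeff_monomial, if_neg (h k hk).symm]

theorem coeff_inFirst_of_ne {p : Polynomial ℝ} {i : Fin (3 * n)} (hi : i ≠ first n) :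
    coeff (Finsupp.single i 1) (inFirst p) = 0 := by
  by_contra h
  obtain ⟨k, -, hk⟩ := exists_of_mem_support_inFirst (mem_support_iff.2 h)
  have := DFunLike.congr_fun hk i
  simp [hi.symm] at this

theorem inFirst_injective :
    Function.Injective (inFirst : Polynomial ℝ → MvPolynomial (Fin (3 * n)) ℝ) := fun p q h => by
  ext k
  rw [← coeff_single_inFirst (n := n), h, coeff_single_inFirst]

theorem aeval_inFirst {A : Type*} [CommRing A] [Algebra ℝ A] (a : Fin (3 * n) → A)
    (p : Polynomial ℝ) : aeval a (inFirst p) = Polynomial.aeval (a (first n)) p := by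
  rw [inFirst, ← Polynomial.aeval_algHom_apply, aeval_X]

theorem coeff_X_sub_inFirst {i j : Fin (3 * n)} (hi : i ≠ first n) (p : Polynomial ℝ) :
    coeff (Finsupp.single i 1) (X j - inFirst p) = if j = i then 1 else 0 := by
  classical
  rw [coeff_sub, coeff_inFirst_of_ne hi, sub_zero, coeff_X]
  simp [Finsupp.single_left_inj]

/-- The coefficients at the variables other than y₁ tell which element of the set plays which role.
-/
theorem HasShape.unique {G : Set (MvPolynomial (Fin (3 * n)) ℝ)} {w w' : Polynomial ℝ}
    {u u' : Fin (3 * n) → Polynomial ℝ} (h : HasShape G w u) (h' : HasShape G w' u') :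
    w = w' ∧ u = u' := by
  obtain ⟨hu, rfl⟩ := h
  obtain ⟨hu', h'⟩ := h'
  constructor
  · have hw : inFirst w ∈ ({inFirst w'} ∪ {p | ∃ i, i ≠ first n ∧ p = X i - inFirst (u' i)} :
        Set (MvPolynomial (Fin (3 * n)) ℝ)) := h' ▸ Or.inl rfl
    rcases hw with hw | ⟨i, hi, hw⟩
    · exact inFirst_injective hw
    · have := congrArg (coeff (Finsupp.single i 1)) hw
      rw [coeff_inFirst_of_ne hi, coeff_X_sub_inFirst hi, if_pos rfl] at this
      exact absurd this zero_ne_one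
  · funext i
    by_cases hi : i = first n
    · rw [hi, hu, hu']
    have hmem : X i - inFirst (u i) ∈ ({inFirst w'} ∪
        {p | ∃ i, i ≠ first n ∧ p = X i - inFirst (u' i)} :
        Set (MvPolynomial (Fin (3 * n)) ℝ)) := h' ▸ Or.inr ⟨i, hi, rfl⟩
    rcases hmem with hw | ⟨j, hj, hw⟩
    · have := congrArg (coeff (Finsupp.single i 1)) hw
      rw [coeff_inFirst_of_ne hi, coeff_X_sub_inFirst hi, if_pos rfl] at this
      exact absurd this one_ne_zero
    · have := congrArg (coeff (Finsupp.single i 1)) hw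
      rw [coeff_X_sub_inFirst hi, coeff_X_sub_inFirst hi, if_pos rfl] at this
      have hji : j = i := by
        by_contra hne
        rw [if_neg hne] at this
        exact one_ne_zero this
      subst hji
      exact inFirst_injective (sub_right_injective hw)

/-! ### Leading terms -/

/-- This is where the lexicographic order matters: it makes yᵢ the leading monomial of yᵢ - uᵢ(y₁)
whatever the degree of uᵢ. -/
theorem single_first_lt {i : Fin (3 * n)} (hi : i ≠ first n) (k : ℕ) :
    (lexAsc (3 * n)).toSyn (Finsupp.single (first n) k) <
      (lexAsc (3 * n)).toSyn (Finsupp.single i 1) := by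
  have hlt : first n < i :=
    lt_of_le_of_ne (Fin.le_def.2 (Nat.zero_le _)) hi.symm
  refine (lexAsc_lt_iff _ _ _).2 ⟨i, fun j hj => ?_, ?_⟩
  · rw [Finsupp.single_eq_of_ne (hlt.trans hj).ne', Finsupp.single_eq_of_ne hj.ne']
  · simp [hi.symm]

theorem degree_inFirst_lt {i : Fin (3 * n)} (hi : i ≠ first n) (p : Polynomial ℝ) :
    (lexAsc (3 * n)).toSyn ((lexAsc (3 * n)).degree (inFirst p)) <
      (lexAsc (3 * n)).toSyn ((lexAsc (3 * n)).degree (X i : MvPolynomial (Fin (3 * n)) ℝ)) := by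
  rw [MonomialOrder.degree_X]
  by_cases h : (inFirst p : MvPolynomial (Fin (3 * n)) ℝ) = 0
  · rw [h, MonomialOrder.degree_zero]
    simpa using single_first_lt hi 0
  · obtain ⟨k, -, hk⟩ := exists_of_mem_support_inFirst ((lexAsc (3 * n)).degree_mem_support h)
    rw [hk]
    exact single_first_lt hi k

theorem degree_X_sub_inFirst {i : Fin (3 * n)} (hi : i ≠ first n) (p : Polynomial ℝ) :
    (lexAsc (3 * n)).degree (X i - inFirst p : MvPolynomial (Fin (3 * n)) ℝ) =
      Finsupp.single i 1 := by
  rw [MonomialOrder.degree_sub_of_lt (degree_inFirst_lt hi p), MonomialOrder.degree_X]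

theorem leadingCoeff_X_sub_inFirst {i : Fin (3 * n)} (hi : i ≠ first n) (p : Polynomial ℝ) :
    (lexAsc (3 * n)).leadingCoeff (X i - inFirst p : MvPolynomial (Fin (3 * n)) ℝ) = 1 := by
  rw [MonomialOrder.leadingCoeff, degree_X_sub_inFirst hi, coeff_X_sub_inFirst hi, if_pos rfl]

theorem single_first_le_iff {k l : ℕ} :
    (lexAsc (3 * n)).toSyn (Finsupp.single (first n) k) ≤
      (lexAsc (3 * n)).toSyn (Finsupp.single (first n) l) ↔ k ≤ l := by
  have h : ∀ {k l : ℕ}, k ≤ l → (lexAsc (3 * n)).toSyn (Finsupp.single (first n) k) ≤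
      (lexAsc (3 * n)).toSyn (Finsupp.single (first n) l) := fun h =>
    (lexAsc (3 * n)).toSyn_monotone (Finsupp.single_mono h)
  refine ⟨fun hkl => ?_, h⟩
  by_contra! hlt
  have := Finsupp.single_injective _ ((lexAsc (3 * n)).toSyn.injective (hkl.antisymm (h hlt.le)))
  omega

theorem degree_inFirst {p : Polynomial ℝ} (hp : p ≠ 0) :
    (lexAsc (3 * n)).degree (inFirst p : MvPolynomial (Fin (3 * n)) ℝ) =
      Finsupp.single (first n) p.natDegree := by
  apply (lexAsc (3 * n)).toSyn.injective
  refine le_antisymm (MonomialOrder.degree_le_iff.2 fun c hc => ?_)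
    (MonomialOrder.le_degree (mem_support_iff.2 ?_))
  · obtain ⟨k, hk, rfl⟩ := exists_of_mem_support_inFirst hc
    exact single_first_le_iff.2 (Polynomial.le_natDegree_of_mem_supp k hk)
  · rwa [coeff_single_inFirst, Polynomial.coeff_natDegree, Polynomial.leadingCoeff_ne_zero]

theorem leadingCoeff_inFirst {p : Polynomial ℝ} (hp : p.Monic) :
    (lexAsc (3 * n)).leadingCoeff (inFirst p : MvPolynomial (Fin (3 * n)) ℝ) = 1 := by
  rw [MonomialOrder.leadingCoeff, degree_inFirst hp.ne_zero, coeff_single_inFirst]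
  exact hp

/-- Elimination property of the lexicographic order: an exponent involving another variable would
exceed every power of y₁. -/
theorem exists_eq_inFirst {p : MvPolynomial (Fin (3 * n)) ℝ} {k : ℕ}
    (hp : (lexAsc (3 * n)).degree p = Finsupp.single (first n) k) :
    ∃ q : Polynomial ℝ, p = inFirst q := by
  have hsupp : ∀ d ∈ p.support, d = Finsupp.single (first n) (d (first n)) := by
    intro d hd
    by_contra hne
    obtain ⟨i, hi⟩ := DFunLike.ne_iff.1 hne
    have hi1 : i ≠ first n := by
      rintro rfl
      simp at hi
    have hle : Finsupp.single i 1 ≤ d := by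
      rw [Finsupp.single_eq_of_ne hi1] at hi
      exact Finsupp.single_le_iff.2 (Nat.one_le_iff_ne_zero.2 hi)
    have h1 := (lexAsc (3 * n)).toSyn_monotone hle
    have h2 := MonomialOrder.le_degree (m := lexAsc (3 * n)) hd
    rw [hp] at h2
    exact absurd (h1.trans h2) (single_first_lt hi1 k).not_ge
  refine ⟨∑ d ∈ p.support, Polynomial.monomial (d (first n)) (coeff d p), ?_⟩
  conv_lhs => rw [p.as_sum]
  rw [inFirst, map_sum]
  refine Finset.sum_congr rfl fun d hd => ?_
  rw [Polynomial.aeval_monomial, X_pow_eq_monomial, ← hsupp d hd, algebraMap_eq, C_mul_monomial,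
    mul_one]

end inFirst

section

variable {n : ℕ} [NeZero n]

/-! ### The shape lemma -/

/-- The coordinate `y₁` separates the complex points of `J`. -/
def Separates (J : Ideal (MvPolynomial (Fin (3 * n)) ℝ)) : Prop :=
  Set.InjOn (fun a : Fin (3 * n) → ℂ => a (first n)) (complexVariety J)

/-- Hilbert's Nullstellensatz for a real ideal and its points over the algebraic closure. -/
theorem mem_radical_iff_forall_complexVariety {σ : Type*} [Finite σ]
    {J : Ideal (MvPolynomial σ ℝ)} {p : MvPolynomial σ ℝ} :
    p ∈ J.radical ↔ ∀ a ∈ complexVariety J, aeval a p = 0 := by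
  rw [← vanishingIdeal_zeroLocus_eq_radical (K := ℂ) J]
  rfl

theorem conj_mem_complexVariety {σ : Type*} {J : Ideal (MvPolynomial σ ℝ)} {a : σ → ℂ}
    (ha : a ∈ complexVariety J) : (fun i => conj (a i)) ∈ complexVariety J := by
  intro g hg
  have h : (aeval fun i => conj (a i)) g = Complex.conjAe (aeval a g) :=
    (comp_aeval_apply a Complex.conjAe.toAlgHom g).symm
  rw [h, ha g hg, map_zero]

/-- If a reduced Gröbner basis has the form `[w, y₂ - u₂, …]`, then `y₁` separates. -/
theorem HasShape.separates {J : Ideal (MvPolynomial (Fin (3 * n)) ℝ)}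
    {G : Set (MvPolynomial (Fin (3 * n)) ℝ)} (hG : ∀ p ∈ G, p ∈ J.radical)
    {w : Polynomial ℝ} {u : Fin (3 * n) → Polynomial ℝ} (h : HasShape G w u) : Separates J := by
  have key : ∀ a ∈ complexVariety J, ∀ i, i ≠ first n →
      a i = Polynomial.aeval (a (first n)) (u i) := by
    intro a ha i hi
    have hmem : X i - inFirst (u i) ∈ G := h.2 ▸ Or.inr ⟨i, hi, rfl⟩
    have := mem_radical_iff_forall_complexVariety.1 (hG _ hmem) a ha
    rwa [map_sub, aeval_X, aeval_inFirst, sub_eq_zero] at this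
  intro a ha b hb hab
  funext i
  by_cases hi : i = first n
  · rw [hi]
    exact hab
  · rw [key a ha i hi, key b hb i hi]
    exact congrArg (fun z => Polynomial.aeval z (u i)) hab

/-- `w` and `u` parametrize the complex points of `J` by their first coordinates. -/
structure IsShapeOf (J : Ideal (MvPolynomial (Fin (3 * n)) ℝ)) (w : Polynomial ℝ)
    (u : Fin (3 * n) → Polynomial ℝ) : Prop where
  monic : w.Monic
  natDegree_eq : w.natDegree = (complexVariety J).ncard
  aeval_eq_zero_iff : ∀ z : ℂ, Polynomial.aeval z w = 0 ↔ ∃ a ∈ complexVariety J, a (first n) = z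
  first_eq : u (first n) = Polynomial.X
  degree_lt : ∀ i, i ≠ first n → (u i).degree < w.degree
  aeval_eq : ∀ a ∈ complexVariety J, ∀ i, Polynomial.aeval (a (first n)) (u i) = a i

theorem Separates.exists_isShapeOf {J : Ideal (MvPolynomial (Fin (3 * n)) ℝ)}
    (hJ : Separates J) (hfin : (complexVariety J).Finite) : ∃ w u, IsShapeOf J w u := by
  classical
  let S : Finset ℂ := hfin.toFinset.image fun a => a (first n)
  have hmemS : ∀ z, z ∈ S ↔ ∃ a ∈ complexVariety J, a (first n) = z := by
    intro z
    simp [S]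
  have hS : ∀ z ∈ S, conj z ∈ S := by
    intro z hz
    obtain ⟨a, ha, rfl⟩ := (hmemS z).1 hz
    exact (hmemS _).2 ⟨_, conj_mem_complexVariety ha, rfl⟩
  have hcard : S.card = (complexVariety J).ncard := by
    rw [Set.ncard_eq_toFinset_card _ hfin]
    exact Finset.card_image_of_injOn (by simpa [Separates] using hJ)
  obtain ⟨w, hw, hwd, hw0⟩ := exists_real_monic_rootSet S hS
  choose! pt hpt hpt1 using fun z hz => (hmemS z).1 hz
  have hpt' : ∀ a ∈ complexVariety J, pt (a (first n)) = a := fun a ha =>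
    have hz := (hmemS _).2 ⟨a, ha, rfl⟩
    hJ (hpt _ hz) ha (hpt1 _ hz)
  have hu : ∀ i : Fin (3 * n), ∃ u : Polynomial ℝ, u.degree < S.card ∧
      ∀ z ∈ S, Polynomial.aeval z u = pt z i := fun i =>
    exists_real_interpolation S hS (fun z => pt z i) fun z hz => by
      obtain ⟨a, ha, rfl⟩ := (hmemS z).1 hz
      rw [hpt' a ha]
      exact congrFun (hpt' _ (conj_mem_complexVariety ha)) i
  choose u hud hu using hu
  -- The interpolant of the first coordinate is replaced by X, which takes the same values at the
  -- nodes; for a single node that interpolant is a constant.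
  refine ⟨w, Function.update u (first n) Polynomial.X, hw, hwd.trans hcard,
    fun z => (hw0 z).trans (hmemS z), Function.update_self .., fun i hi => ?_, fun a ha i => ?_⟩
  · rw [Function.update_of_ne hi, Polynomial.degree_eq_natDegree hw.ne_zero, hwd]
    exact hud i
  · by_cases hi : i = first n
    · subst hi
      rw [Function.update_self, Polynomial.aeval_X]
    · rw [Function.update_of_ne hi, hu i _ ((hmemS _).2 ⟨a, ha, rfl⟩), hpt' a ha]

/-- Such a q vanishes at the first coordinates of all points, and these are distinct. -/
theorem IsShapeOf.natDegree_le_of_inFirst_mem {J : Ideal (MvPolynomial (Fin (3 * n)) ℝ)}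
    {w : Polynomial ℝ} {u : Fin (3 * n) → Polynomial ℝ} (h : IsShapeOf J w u)
    (hJ : Separates J) (hfin : (complexVariety J).Finite) {q : Polynomial ℝ} (hq : q ≠ 0)
    (hmem : inFirst q ∈ J.radical) : w.natDegree ≤ q.natDegree := by
  classical
  rw [h.natDegree_eq, Set.ncard_eq_toFinset_card _ hfin,
    ← Finset.card_image_of_injOn (f := fun a : Fin (3 * n) → ℂ => a (first n))
      (by simpa [Separates] using hJ)]
  have hq' : q.map (algebraMap ℝ ℂ) ≠ 0 :=
    (Polynomial.map_ne_zero_iff (algebraMap ℝ ℂ).injective).2 hq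
  rw [← Polynomial.natDegree_map (algebraMap ℝ ℂ)]
  refine (Finset.card_le_card (t := (q.map (algebraMap ℝ ℂ)).roots.toFinset) ?_).trans
    ((Multiset.toFinset_card_le _).trans (Polynomial.card_roots' _))
  intro z hz
  obtain ⟨a, ha, rfl⟩ := Finset.mem_image.1 hz
  rw [Multiset.mem_toFinset, Polynomial.mem_roots hq', Polynomial.IsRoot,
    Polynomial.eval_map_algebraMap, ← aeval_inFirst]
  exact mem_radical_iff_forall_complexVariety.1 hmem a (hfin.mem_toFinset.1 ha)

theorem IsShapeOf.isReducedGroebnerBasis {J : Ideal (MvPolynomial (Fin (3 * n)) ℝ)}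
    {w : Polynomial ℝ} {u : Fin (3 * n) → Polynomial ℝ} (h : IsShapeOf J w u)
    (hJ : Separates J) (hfin : (complexVariety J).Finite) (hne : (complexVariety J).Nonempty) :
    IsReducedGroebnerBasis (lexAsc (3 * n)) J.radical
      ({inFirst w} ∪ {p | ∃ i, i ≠ first n ∧ p = X i - inFirst (u i)}) := by
  have hw0 := h.monic.ne_zero
  refine isReducedGroebnerBasis_iff.2 ⟨?_, ?_, ?_, ?_, ?_⟩
  · refine (Set.finite_singleton _).union
      ((Set.finite_range fun i => X i - inFirst (u i)).subset ?_)
    rintro _ ⟨i, -, rfl⟩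
    exact ⟨i, rfl⟩
  · rintro _ (rfl | ⟨i, -, rfl⟩) <;>
      refine mem_radical_iff_forall_complexVariety.2 fun a ha => ?_
    · rw [aeval_inFirst]
      exact (h.aeval_eq_zero_iff _).2 ⟨a, ha, rfl⟩
    · rw [map_sub, aeval_X, aeval_inFirst, h.aeval_eq a ha, sub_self]
  · rintro _ (rfl | ⟨i, hi, rfl⟩)
    · exact leadingCoeff_inFirst h.monic
    · exact leadingCoeff_X_sub_inFirst hi _
  · intro p hp hp0
    -- Either some yᵢ other than y₁ divides the leading monomial, or p is a polynomial in y₁ alone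
    -- and the degree of w is minimal among these.
    by_cases hex : ∃ i, i ≠ first n ∧ (lexAsc (3 * n)).degree p i ≠ 0
    · obtain ⟨i, hi, hpi⟩ := hex
      refine ⟨_, Or.inr ⟨i, hi, rfl⟩, ?_⟩
      rw [degree_X_sub_inFirst hi]
      exact Finsupp.single_le_iff.2 (Nat.one_le_iff_ne_zero.2 hpi)
    · push Not at hex
      have hdeg : (lexAsc (3 * n)).degree p =
          Finsupp.single (first n) ((lexAsc (3 * n)).degree p (first n)) := by
        ext i
        by_cases hi : i = first n
        · rw [hi, Finsupp.single_eq_same]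
        · rw [Finsupp.single_eq_of_ne hi, hex i hi]
      obtain ⟨q, rfl⟩ := exists_eq_inFirst hdeg
      have hq : q ≠ 0 := by
        rintro rfl
        simp [inFirst] at hp0
      refine ⟨_, Or.inl rfl, ?_⟩
      rw [degree_inFirst hw0, degree_inFirst hq]
      exact Finsupp.single_mono (h.natDegree_le_of_inFirst_mem hJ hfin hq hp)
  · rintro _ (rfl | ⟨i, hi, rfl⟩) d hd _ (rfl | ⟨j, hj, rfl⟩) hgp hle
    · exact hgp rfl
    · rw [degree_X_sub_inFirst hj, Finsupp.single_le_iff] at hle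
      obtain ⟨k, -, rfl⟩ := exists_of_mem_support_inFirst hd
      rw [Finsupp.single_eq_of_ne hj] at hle
      omega
    · rw [degree_inFirst hw0, Finsupp.single_le_iff] at hle
      classical
      rcases Finset.mem_union.1 (support_sub _ _ _ hd) with hs | hs
      · rw [support_X, Finset.mem_singleton] at hs
        rw [hs, Finsupp.single_eq_of_ne hi.symm, Nat.le_zero] at hle
        -- A nonempty variety excludes w = 1, whose leading monomial would divide everything.
        exact ((Set.ncard_pos hfin).2 hne).ne' (h.natDegree_eq ▸ hle)
      · obtain ⟨k, hk, rfl⟩ := exists_of_mem_support_inFirst hs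
        rw [Finsupp.single_eq_same] at hle
        have := (Polynomial.le_degree_of_mem_supp k hk).trans_lt (h.degree_lt i hi)
        rw [Polynomial.degree_eq_natDegree hw0, Nat.cast_lt] at this
        omega
    · have hij : j ≠ i := fun hij => hgp (by rw [hij])
      rw [degree_X_sub_inFirst hj, Finsupp.single_le_iff] at hle
      classical
      rcases Finset.mem_union.1 (support_sub _ _ _ hd) with hs | hs
      · rw [support_X, Finset.mem_singleton] at hs
        rw [hs, Finsupp.single_eq_of_ne hij] at hle
        omega
      · obtain ⟨k, -, rfl⟩ := exists_of_mem_support_inFirst hs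
        rw [Finsupp.single_eq_of_ne hj] at hle
        omega

end

/-! ### The variety of the slack ideal -/

section slack

variable {n : ℕ}

theorem exists_index_eq (k : Fin (3 * n)) :
    (∃ i, k = xIdx i) ∨ (∃ i, k = zIdx i) ∨ ∃ i, k = zIdx' i := by
  obtain ⟨k, hk⟩ := k
  rcases lt_or_ge k n with h | h
  · exact .inl ⟨⟨k, h⟩, rfl⟩
  rcases lt_or_ge k (2 * n) with h' | h'
  · exact .inr (.inl ⟨⟨k - n, by omega⟩, Fin.ext (by simp [zIdx]; omega)⟩)
  · exact .inr (.inr ⟨⟨k - 2 * n, by omega⟩, Fin.ext (by simp [zIdx']; omega)⟩)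

theorem mem_complexVariety_span_range {σ ι : Type*} {g : ι → MvPolynomial σ ℝ} {a : σ → ℂ} :
    a ∈ complexVariety (Ideal.span (Set.range g)) ↔ ∀ k, aeval a (g k) = 0 := by
  change a ∈ zeroLocus ℂ (Ideal.span (Set.range g)) ↔ _
  rw [zeroLocus_span]
  simp

variable {f : Fin n → MvPolynomial (Fin n) ℝ}

theorem mem_complexVariety_compIdeal {a : Fin n → ℂ} :
    a ∈ complexVariety (compIdeal f) ↔ ∀ i, a i * aeval a (f i) = 0 := by
  simp [compIdeal, mem_complexVariety_span_range]

theorem mem_complexVariety_slackIdeal {a : Fin (3 * n) → ℂ} :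
    a ∈ complexVariety (slackIdeal f) ↔
      (∀ i, a (xIdx i) * aeval (fun j => a (xIdx j)) (f i) = 0) ∧
      (∀ i, a (zIdx i) ^ 2 = a (xIdx i)) ∧
      ∀ i, a (zIdx' i) ^ 2 = aeval (fun j => a (xIdx j)) (f i) := by
  rw [slackIdeal, mem_complexVariety_span_range, Sum.forall, Sum.forall]
  simp only [slackPolys, map_mul, map_sub, map_pow, aeval_X, aeval_rename, sub_eq_zero]
  rfl

theorem finite_setOf_sq_eq (b : ℂ) : {c : ℂ | c ^ 2 = b}.Finite := by
  refine (Polynomial.nthRoots 2 b).toFinset.finite_toSet.subset fun c hc => ?_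
  simpa [Polynomial.mem_nthRoots] using hc

theorem finite_complexVariety_slackIdeal (hf : IsD0 f) :
    (complexVariety (slackIdeal f)).Finite := by
  let T : (Fin n → ℂ) → Set ℂ := fun x => Set.range x ∪
    ((⋃ i, {c | c ^ 2 = x i}) ∪ ⋃ i, {c | c ^ 2 = aeval x (f i)})
  have hT : ∀ x, (T x).Finite := fun x => (Set.finite_range x).union
    ((Set.finite_iUnion fun _ => finite_setOf_sq_eq _).union
      (Set.finite_iUnion fun _ => finite_setOf_sq_eq _))
  refine (hf.biUnion fun x _ => Set.Finite.pi' fun _ : Fin (3 * n) => hT x).subset fun a ha => ?_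
  obtain ⟨h1, h2, h3⟩ := mem_complexVariety_slackIdeal.1 ha
  refine Set.mem_biUnion (mem_complexVariety_compIdeal.2 h1) fun k => ?_
  rcases exists_index_eq k with ⟨i, rfl⟩ | ⟨i, rfl⟩ | ⟨i, rfl⟩
  · exact .inl ⟨i, rfl⟩
  · exact .inr (.inl (Set.mem_iUnion.2 ⟨i, h2 i⟩))
  · exact .inr (.inr (Set.mem_iUnion.2 ⟨i, h3 i⟩))

/-- A vector of length `3 n` may be prescribed on its three blocks. -/
theorem exists_vector_of_blocks {R : Type*} (x s t : Fin n → R) :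
    ∃ a : Fin (3 * n) → R, (∀ i, a (xIdx i) = x i) ∧ (∀ i, a (zIdx i) = s i) ∧
      ∀ i, a (zIdx' i) = t i := by
  refine ⟨fun k => if h : (k : ℕ) < n then x ⟨k, h⟩ else
    if h' : (k : ℕ) < 2 * n then s ⟨k - n, by omega⟩ else t ⟨k - 2 * n, by omega⟩, ?_, ?_, ?_⟩
  · intro i
    simp [xIdx]
  · intro i
    have : n + (i : ℕ) < 2 * n := by omega
    simp [zIdx, this]
  · intro i
    have : ¬ 2 * n + (i : ℕ) < n := by omega
    simp [zIdx', this]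

/-- Put x = 0 and take complex square roots of the values f_i(0). -/
theorem nonempty_complexVariety_slackIdeal : (complexVariety (slackIdeal f)).Nonempty := by
  choose t ht using fun i => IsAlgClosed.exists_pow_nat_eq (aeval (0 : Fin n → ℂ) (f i)) two_pos
  obtain ⟨a, h1, h2, h3⟩ := exists_vector_of_blocks (0 : Fin n → ℂ) 0 t
  refine ⟨a, mem_complexVariety_slackIdeal.2 ⟨?_, ?_, ?_⟩⟩
  · simp [h1]
  · simp [h1, h2]
  · intro i
    rw [h3, ht, funext h1]

theorem aeval_ofReal {σ : Type*} (b : σ → ℝ) (p : MvPolynomial σ ℝ) :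
    aeval (fun k => (b k : ℂ)) p = ((eval b p : ℝ) : ℂ) :=
  aeval_algebraMap_apply (A := ℝ) ℂ b p

theorem ofReal_mem_complexVariety_slackIdeal {b : Fin (3 * n) → ℝ} :
    (fun k => (b k : ℂ)) ∈ complexVariety (slackIdeal f) ↔
      (∀ i, b (xIdx i) * eval (fun j => b (xIdx j)) (f i) = 0) ∧
      (∀ i, b (zIdx i) ^ 2 = b (xIdx i)) ∧
      ∀ i, b (zIdx' i) ^ 2 = eval (fun j => b (xIdx j)) (f i) := by
  rw [mem_complexVariety_slackIdeal]
  simp only [aeval_ofReal]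
  norm_cast

/-- `Sol(f)` is the projection of the set of real points of `V(I[f, z])`. -/
theorem mem_Sol_iff {α : Fin n → ℝ} : α ∈ Sol f ↔ ∃ b : Fin (3 * n) → ℝ,
    (fun k => (b k : ℂ)) ∈ complexVariety (slackIdeal f) ∧ ∀ i, α i = b (xIdx i) := by
  constructor
  · rintro ⟨h1, h2, h3⟩
    have h3' := (Finset.sum_eq_zero_iff_of_nonneg fun i _ => mul_nonneg (h1 i) (h2 i)).1 h3
    -- Nonnegativity provides real slack values.
    obtain ⟨b, hx, hs, ht⟩ := exists_vector_of_blocks α (fun i => √(α i)) fun i => √(eval α (f i))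
    refine ⟨b, ofReal_mem_complexVariety_slackIdeal.2 ⟨fun i => ?_, fun i => ?_, fun i => ?_⟩,
      fun i => (hx i).symm⟩
    · rw [funext hx, hx]
      exact h3' i (Finset.mem_univ i)
    · rw [hs, hx, Real.sq_sqrt (h1 i)]
    · rw [ht, funext hx, Real.sq_sqrt (h2 i)]
  · rintro ⟨b, hb, hα⟩
    obtain rfl : α = fun i => b (xIdx i) := funext hα
    obtain ⟨h1, h2, h3⟩ := ofReal_mem_complexVariety_slackIdeal.1 hb
    exact ⟨fun i => (sq_nonneg _).trans_eq (h2 i), fun i => (sq_nonneg _).trans_eq (h3 i),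
      Finset.sum_eq_zero fun i _ => h1 i⟩

end slack

/-! ### The change of variables -/

section changeOfVariables

variable {n : ℕ} [NeZero n] {f : Fin n → MvPolynomial (Fin n) ℝ}

/-- The matrix is upper triangular with unit diagonal; the corner entry is s ^ 0 = 1, also for s =
0. -/
theorem det_rowMatrix (s : ℕ) : (rowMatrix n s).det = 1 := by
  rw [Matrix.det_of_isUpperTriangular]
  · refine Finset.prod_eq_one fun i _ => ?_
    by_cases h : i = first n
    · simp [rowMatrix, h, first]
    · simp [rowMatrix, h]
  · intro i j hij
    have h1 : i ≠ first n := by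
      rintro rfl
      exact absurd (Fin.lt_def.1 hij) (Nat.not_lt_zero _)
    have h2 : i ≠ j := (show j < i from hij).ne'
    simp [rowMatrix, h1, h2]

theorem H_mul_rowMatrix (s : ℕ) : H n s * rowMatrix n s = 1 :=
  Matrix.nonsing_inv_mul _ (by rw [det_rowMatrix]; exact isUnit_one)

theorem rowMatrix_mul_H (s : ℕ) : rowMatrix n s * H n s = 1 :=
  Matrix.mul_nonsing_inv _ (by rw [det_rowMatrix]; exact isUnit_one)

/-- Application of a real matrix to a complex vector. -/
noncomputable def realMulVec {m : ℕ} (A : Matrix (Fin m) (Fin m) ℝ) (a : Fin m → ℂ) : Fin m → ℂ :=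
  fun i => ∑ j, (A i j : ℂ) * a j

theorem realMulVec_eq {m : ℕ} (A : Matrix (Fin m) (Fin m) ℝ) (a : Fin m → ℂ) :
    realMulVec A a = (A.map (algebraMap ℝ ℂ)).mulVec a := rfl

theorem realMulVec_realMulVec_of_mul_eq_one {m : ℕ} {A B : Matrix (Fin m) (Fin m) ℝ}
    (h : A * B = 1) (a : Fin m → ℂ) : realMulVec A (realMulVec B a) = a := by
  rw [realMulVec_eq, realMulVec_eq, Matrix.mulVec_mulVec, ← Matrix.map_mul, h,
    Matrix.map_one _ (map_zero _) (map_one _), Matrix.one_mulVec]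

theorem realMulVec_ofReal {m : ℕ} (A : Matrix (Fin m) (Fin m) ℝ) (b : Fin m → ℝ) :
    realMulVec A (fun k => (b k : ℂ)) = fun k => ((A.mulVec b k : ℝ) : ℂ) := by
  funext k
  simp [realMulVec, Matrix.mulVec, dotProduct]

theorem mem_complexVariety_transformedIdeal {s : ℕ} {a : Fin (3 * n) → ℂ} :
    a ∈ complexVariety (transformedIdeal f s) ↔
      realMulVec (H n s) a ∈ complexVariety (slackIdeal f) := by
  rw [transformedIdeal, slackIdeal, mem_complexVariety_span_range, mem_complexVariety_span_range]
  refine forall_congr' fun k => ?_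
  rw [comp_aeval_apply]
  have : (fun i => aeval a (∑ j, C (H n s i j) * X j)) = realMulVec (H n s) a := by
    funext i
    simp [realMulVec]
  rw [this]

theorem complexVariety_transformedIdeal (s : ℕ) :
    complexVariety (transformedIdeal f s) =
      realMulVec (rowMatrix n s) '' complexVariety (slackIdeal f) := by
  ext a
  rw [mem_complexVariety_transformedIdeal]
  constructor
  · exact fun h => ⟨_, h, realMulVec_realMulVec_of_mul_eq_one (rowMatrix_mul_H s) a⟩
  · rintro ⟨b, hb, rfl⟩
    rwa [realMulVec_realMulVec_of_mul_eq_one (H_mul_rowMatrix s)]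

theorem realMulVec_rowMatrix_injective (s : ℕ) :
    Function.Injective (realMulVec (rowMatrix n s)) :=
  Function.LeftInverse.injective (realMulVec_realMulVec_of_mul_eq_one (H_mul_rowMatrix s))

theorem finite_complexVariety_transformedIdeal (hf : IsD0 f) (s : ℕ) :
    (complexVariety (transformedIdeal f s)).Finite := by
  rw [complexVariety_transformedIdeal]
  exact (finite_complexVariety_slackIdeal hf).image _

theorem nonempty_complexVariety_transformedIdeal (s : ℕ) :
    (complexVariety (transformedIdeal f s)).Nonempty := by
  rw [complexVariety_transformedIdeal]
  exact nonempty_complexVariety_slackIdeal.image _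

theorem ncard_complexVariety_transformedIdeal (s : ℕ) :
    (complexVariety (transformedIdeal f s)).ncard = (complexVariety (slackIdeal f)).ncard := by
  rw [complexVariety_transformedIdeal,
    Set.ncard_image_of_injective _ (realMulVec_rowMatrix_injective s)]

/-! ### Counting the values of `s` for which `y₁` does not separate -/

theorem realMulVec_rowMatrix_first (s : ℕ) (a : Fin (3 * n) → ℂ) :
    realMulVec (rowMatrix n s) a (first n) = ∑ j : Fin (3 * n), (s : ℂ) ^ (j : ℕ) * a j := by
  simp [realMulVec, rowMatrix]

theorem exists_ne_of_not_separates {s : ℕ} (h : ¬ Separates (transformedIdeal f s)) :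
    ∃ a ∈ complexVariety (slackIdeal f), ∃ b ∈ complexVariety (slackIdeal f), a ≠ b ∧
      ∑ j : Fin (3 * n), (s : ℂ) ^ (j : ℕ) * a j = ∑ j : Fin (3 * n), (s : ℂ) ^ (j : ℕ) * b j := by
  simp only [Separates, Set.InjOn, complexVariety_transformedIdeal, Set.forall_mem_image,
    realMulVec_rowMatrix_first, not_forall] at h
  obtain ⟨a, ha, b, hb, hab, hne⟩ := h
  exact ⟨a, ha, b, hb, fun h => hne (h ▸ rfl), hab⟩

/-- Each such s is a root of the nonzero polynomial with coefficients aⱼ - bⱼ, of degree at most m -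
1. -/
theorem card_le_of_forall_sum_pow_mul_eq {m : ℕ} {a b : Fin m → ℂ} (hab : a ≠ b) (B : Finset ℕ)
    (hB : ∀ s ∈ B, ∑ j : Fin m, (s : ℂ) ^ (j : ℕ) * a j = ∑ j : Fin m, (s : ℂ) ^ (j : ℕ) * b j) :
    B.card ≤ m - 1 := by
  classical
  let P : Polynomial ℂ := ∑ j : Fin m, Polynomial.monomial (j : ℕ) (a j - b j)
  have hcoeff : ∀ i : Fin m, P.coeff i = a i - b i := by
    intro i
    simp [P, Polynomial.coeff_monomial, Fin.val_inj]
  have hP : P ≠ 0 := by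
    intro h
    refine hab (funext fun i => sub_eq_zero.1 ?_)
    rw [← hcoeff, h, Polynomial.coeff_zero]
  have hdeg : P.natDegree ≤ m - 1 :=
    Polynomial.natDegree_sum_le_of_forall_le _ _ fun j _ =>
      (Polynomial.natDegree_monomial_le _).trans (by omega)
  rw [← Finset.card_image_of_injective B (Nat.cast_injective (R := ℂ))]
  refine (Finset.card_le_card (t := P.roots.toFinset) fun z hz => ?_).trans
    ((Multiset.toFinset_card_le _).trans ((Polynomial.card_roots' _).trans hdeg))
  obtain ⟨s, hs, rfl⟩ := Finset.mem_image.1 hz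
  rw [Multiset.mem_toFinset, Polynomial.mem_roots hP, Polynomial.IsRoot,
    Polynomial.eval_finsetSum, ← sub_eq_zero.2 (hB s hs), ← Finset.sum_sub_distrib]
  exact Finset.sum_congr rfl fun j _ => by rw [Polynomial.eval_monomial]; ring

theorem exists_separates (hf : IsD0 f) :
    ∃ s ≤ (3 * n - 1) * (complexVariety (slackIdeal f)).ncard *
      ((complexVariety (slackIdeal f)).ncard - 1) / 2, Separates (transformedIdeal f s) := by
  classical
  have hfin := finite_complexVariety_slackIdeal hf
  rw [Set.ncard_eq_toFinset_card _ hfin]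
  set V := hfin.toFinset
  set N := (3 * n - 1) * V.card * (V.card - 1) / 2
  by_contra! hbad
  let Q : Finset (Fin (3 * n) → ℂ) → ℕ → Prop := fun T s => ∃ a ∈ T, ∃ b ∈ T, a ≠ b ∧
    ∑ j : Fin (3 * n), (s : ℂ) ^ (j : ℕ) * a j = ∑ j : Fin (3 * n), (s : ℂ) ^ (j : ℕ) * b j
  -- Each bad s is charged to an unordered pair of points that it merges; unordered pairs give the
  -- factor 1/2.
  have hcover : Finset.range (N + 1) ⊆
      (V.powersetCard 2).biUnion fun T => (Finset.range (N + 1)).filter (Q T) := by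
    intro s hs
    obtain ⟨a, ha, b, hb, hab, heq⟩ :=
      exists_ne_of_not_separates (hbad s (Nat.lt_succ_iff.1 (Finset.mem_range.1 hs)))
    refine Finset.mem_biUnion.2 ⟨{a, b}, Finset.mem_powersetCard.2 ⟨?_, Finset.card_pair hab⟩,
      Finset.mem_filter.2 ⟨hs, a, by simp, b, by simp, hab, heq⟩⟩
    intro c hc
    rcases Finset.mem_insert.1 hc with rfl | hc
    · exact hfin.mem_toFinset.2 ha
    · exact hfin.mem_toFinset.2 (Finset.mem_singleton.1 hc ▸ hb)
  have hle : N + 1 ≤ (V.powersetCard 2).card * (3 * n - 1) := by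
    rw [← Finset.card_range (N + 1)]
    refine (Finset.card_le_card hcover).trans (Finset.card_biUnion_le_card_mul _ _ _ ?_)
    intro T hT
    obtain ⟨a, b, hab, rfl⟩ := Finset.card_eq_two.1 (Finset.mem_powersetCard.1 hT).2
    refine card_le_of_forall_sum_pow_mul_eq hab _ fun s hs => ?_
    obtain ⟨c, hc, d, hd, hcd, heq⟩ := (Finset.mem_filter.1 hs).2
    simp only [Finset.mem_insert, Finset.mem_singleton] at hc hd
    rcases hc with rfl | rfl <;> rcases hd with rfl | rfl
    · exact absurd rfl hcd
    · exact heq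
    · exact heq.symm
    · exact absurd rfl hcd
  rw [Finset.card_powersetCard, Nat.choose_two_right, mul_comm] at hle
  -- Only this inequality between truncated quotients is needed to contradict `hle`.
  have := Nat.mul_div_le_mul_div_assoc (3 * n - 1) (V.card * (V.card - 1)) 2
  rw [← mul_assoc] at this
  omega

end changeOfVariables

theorem Parametrizes.mod {n : ℕ} {f : Fin n → MvPolynomial (Fin n) ℝ} {w : Polynomial ℝ}
    {v : Fin n → Polynomial ℝ} (h : Parametrizes f w v) :
    Parametrizes f w fun i => v i % w := by
  rw [Parametrizes, h]
  ext α
  refine exists_congr fun t => and_congr_right fun ht => ?_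
  have : ∀ i, (v i % w).eval t = (v i).eval t := fun i => by
    conv_rhs => rw [← EuclideanDomain.mod_add_div (v i) w]
    simp [ht]
  simp only [this]

section

variable {n : ℕ} [NeZero n] {f : Fin n → MvPolynomial (Fin n) ℝ}

/-! ### The output -/

theorem eval_outputV (s : ℕ) (u : Fin (3 * n) → Polynomial ℝ) (i : Fin n) (t : ℝ) :
    (outputV s u i).eval t = (H n s).mulVec (fun j => (u j).eval t) (xIdx i) := by
  simp [outputV, Polynomial.eval_finsetSum, Matrix.mulVec, dotProduct]

theorem aeval_complex_ofReal (p : Polynomial ℝ) (t : ℝ) :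
    Polynomial.aeval (t : ℂ) p = ((p.eval t : ℝ) : ℂ) :=
  Polynomial.aeval_algebraMap_apply_eq_algebraMap_eval (A := ℂ) t p

/-- Real points have a real first coordinate, and u, being real, sends a real root of w to a real
point. Since `H n s` and its inverse are real, this matches real roots of w with real points of the
slack variety. -/
theorem IsShapeOf.parametrizes {s : ℕ} {w : Polynomial ℝ} {u : Fin (3 * n) → Polynomial ℝ}
    (h : IsShapeOf (transformedIdeal f s) w u) : Parametrizes f w (outputV s u) := by
  ext α
  rw [mem_Sol_iff]
  constructor
  · rintro ⟨b, hb, hα⟩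
    let y := (rowMatrix n s).mulVec b
    have hy : (fun k => (y k : ℂ)) ∈ complexVariety (transformedIdeal f s) := by
      rw [complexVariety_transformedIdeal]
      exact ⟨_, hb, realMulVec_ofReal _ _⟩
    have hu : (fun j => (u j).eval (y (first n))) = y := funext fun j => by
      have := h.aeval_eq _ hy j
      rw [aeval_complex_ofReal] at this
      exact_mod_cast this
    refine ⟨y (first n), ?_, funext fun i => ?_⟩
    · have := (h.aeval_eq_zero_iff _).2 ⟨_, hy, rfl⟩
      rw [aeval_complex_ofReal] at this
      exact_mod_cast this
    · rw [eval_outputV, hu, hα, Matrix.mulVec_mulVec, H_mul_rowMatrix, Matrix.one_mulVec]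
  · rintro ⟨t, ht, rfl⟩
    obtain ⟨a, ha, hat⟩ := (h.aeval_eq_zero_iff t).1 (by rw [aeval_complex_ofReal, ht]; rfl)
    have haj : a = fun j => (((u j).eval t : ℝ) : ℂ) := funext fun j => by
      rw [← h.aeval_eq a ha j, hat, aeval_complex_ofReal]
    refine ⟨_, ?_, fun i => eval_outputV s u i t⟩
    rw [← realMulVec_ofReal, ← haj]
    exact mem_complexVariety_transformedIdeal.1 ha

/-- The bound 2 is needed for the coordinate u₁ = t, of degree 1; the other coordinates always have
degree below that of w. -/
theorem IsShapeOf.degree_outputV_lt {s : ℕ} {J : Ideal (MvPolynomial (Fin (3 * n)) ℝ)}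
    {w : Polynomial ℝ} {u : Fin (3 * n) → Polynomial ℝ} (h : IsShapeOf J w u)
    (hw : 2 ≤ w.natDegree) (i : Fin n) : (outputV s u i).degree < w.degree := by
  have hw0 := Polynomial.degree_eq_natDegree h.monic.ne_zero
  refine (Polynomial.degree_sum_le _ _).trans_lt
    ((Finset.sup_lt_iff (hw0 ▸ WithBot.bot_lt_coe _)).2 fun j _ => ?_)
  rw [Polynomial.C_mul']
  refine (Polynomial.degree_smul_le _ _).trans_lt ?_
  by_cases hj : j = first n
  · rw [hj, h.first_eq, Polynomial.degree_X, hw0]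
    exact_mod_cast hw
  · exact h.degree_lt j hj

/-! ### Executions of the algorithm -/

theorem Exec.trans {c c' c'' : Config n} {k l : ℕ} (h : Exec f c k c') (h' : Exec f c' l c'') :
    Exec f c (k + l) c'' := by
  induction h' with
  | refl => exact h
  | tail _ hs ih => exact add_assoc k _ _ ▸ ih.tail hs

theorem Step.exec {c c' : Config n} {k : ℕ} (h : Step f c k c') : Exec f c k c' := by
  simpa using (Exec.refl c).tail h

/-- A step may use any reduced basis of the right ideal, but uniqueness of the basis and of its
shape makes the run deterministic. -/
theorem returns_of_forall_lt {s₀ : ℕ} {w : Polynomial ℝ} {u : Fin (3 * n) → Polynomial ℝ}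
    (G : ℕ → Set (MvPolynomial (Fin (3 * n)) ℝ))
    (hG : ∀ s, IsReducedGroebnerBasis (lexAsc (3 * n)) (transformedIdeal f s).radical (G s))
    (hlt : ∀ s < s₀, ¬ ∃ w u, HasShape (G s) w u) (hs₀ : HasShape (G s₀) w u) :
    Returns f (s₀ + 1) w (outputV s₀ u) := by
  have hshaped : Exec f (.shaped s₀ w u) 0 (.returned w (outputV s₀ u)) :=
    (Step.output s₀ w u).exec
  have hloop : ∀ d s, s + d = s₀ → Exec f (.loop s) (d + 1) (.returned w (outputV s₀ u)) := by
    intro d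
    induction d with
    | zero =>
      rintro s rfl
      exact (Step.stop_loop s _ w u (hG s) hs₀).exec.trans hshaped
    | succ d ih =>
      intro s hs
      rw [add_comm]
      exact (Step.again s _ (hG s) (hlt s (by omega))).exec.trans (ih (s + 1) (by omega))
  -- Invariant of all reachable configurations: before stopping, s equals the number of loop
  -- iterations done, and it never exceeds s₀.
  have hinv : ∀ c₀ j c, Exec f c₀ j c → c₀ = .loop 0 →
      (c = .loop j ∧ j ≤ s₀) ∨
      (c = .shaped s₀ w u ∨ c = .returned w (outputV s₀ u)) ∧ j = s₀ + 1 := by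
    intro c₀ j c hexec
    induction hexec with
    | refl =>
      rintro rfl
      exact .inl ⟨rfl, Nat.zero_le _⟩
    | tail _ hstep ih =>
      intro h0
      rcases ih h0 with ⟨rfl, hj⟩ | ⟨rfl | rfl, rfl⟩
      · cases hstep with
        | again _ G' hG' hshape =>
          refine .inl ⟨rfl, Nat.succ_le_of_lt (lt_of_le_of_ne hj ?_)⟩
          rintro rfl
          exact hshape ⟨w, u, hG'.unique (hG _) ▸ hs₀⟩
        | stop_loop _ G' w' u' hG' hshape =>
          rw [hG'.unique (hG _)] at hshape
          rcases hj.lt_or_eq with hj | rfl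
          · exact absurd ⟨w', u', hshape⟩ (hlt _ hj)
          · obtain ⟨rfl, rfl⟩ := hshape.unique hs₀
            exact .inr ⟨.inl rfl, rfl⟩
      · cases hstep
        exact .inr ⟨.inr rfl, rfl⟩
      · cases hstep
  intro j c hexec
  rcases hinv _ j c hexec rfl with ⟨rfl, hj⟩ | ⟨rfl | rfl, rfl⟩
  · exact ⟨s₀ - j + 1, by omega, hloop _ _ (by omega)⟩
  · exact ⟨0, rfl, hshaped⟩
  · exact ⟨0, rfl, .refl _⟩

end

end PCP

/-! ### The main theorem -/

theorem mainTheorem5 (n : ℕ) [NeZero n] (f : Fin n → MvPolynomial (Fin n) ℝ) (hf : PCP.IsD0 f)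
    (δ : ℕ) (hδ : δ = (PCP.complexVariety (PCP.slackIdeal f)).ncard) :
    ∃ (k : ℕ) (w : Polynomial ℝ) (v : Fin n → Polynomial ℝ),
      PCP.Returns f k w v ∧
      k ≤ (3 * n - 1) * δ * (δ - 1) / 2 + 1 ∧
      PCP.Parametrizes f w v ∧
      (2 ≤ δ → PCP.IsUnivariateRepresentation f w v) ∧
      PCP.IsUnivariateRepresentation f w (fun i => v i % w) := by
  classical
  have hex : ∃ s, PCP.Separates (PCP.transformedIdeal f s) :=
    (PCP.exists_separates hf).imp fun _ h => h.2
  obtain ⟨s₁, hs₁, hsep₁⟩ := PCP.exists_separates hf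
  have hsep := Nat.find_spec hex
  have hle := Nat.find_min' hex hsep₁
  have hmin : ∀ s < Nat.find hex, ¬ PCP.Separates (PCP.transformedIdeal f s) :=
    fun s hs => Nat.find_min hex hs
  -- The algorithm stops at the least separating s₀; as s starts at 0, this takes s₀ + 1 iterations.
  generalize Nat.find hex = s₀ at hsep hle hmin
  obtain ⟨w, u, hwu⟩ :=
    hsep.exists_isShapeOf (PCP.finite_complexVariety_transformedIdeal hf s₀)
  have hGwu := hwu.isReducedGroebnerBasis hsep
    (PCP.finite_complexVariety_transformedIdeal hf s₀)
    (PCP.nonempty_complexVariety_transformedIdeal s₀)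
  choose G hG using fun s =>
    PCP.exists_isReducedGroebnerBasis (PCP.lexAsc (3 * n)) (PCP.transformedIdeal f s).radical
  have hret : PCP.Returns f (s₀ + 1) w (PCP.outputV s₀ u) :=
    PCP.returns_of_forall_lt G hG
      (fun s hs ⟨_, _, h⟩ => hmin s hs (h.separates (hG s).subset))
      ⟨hwu.first_eq, (hG s₀).unique hGwu⟩
  have hdeg : w.natDegree = δ := by
    rw [hwu.natDegree_eq, PCP.ncard_complexVariety_transformedIdeal, hδ]
  have hcard : (PCP.complexVariety (PCP.slackIdeal f)).encard = w.natDegree := by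
    rw [hdeg, hδ, (PCP.finite_complexVariety_slackIdeal hf).cast_ncard_eq]
  refine ⟨s₀ + 1, w, PCP.outputV s₀ u, hret, ?_, hwu.parametrizes, fun h2 => ?_, ?_⟩
  · rw [hδ]
    exact Nat.succ_le_succ (hle.trans hs₁)
  · exact ⟨hwu.parametrizes, hcard, hwu.degree_outputV_lt (hdeg ▸ h2)⟩
  · exact ⟨hwu.parametrizes.mod, hcard,
      fun i => EuclideanDomain.mod_lt _ hwu.monic.ne_zero⟩
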